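/- Let $\theta\in(0,\pi/4]$ and let $\alpha\ge\beta>0$ be real with $\alpha^2+\beta^2=1$. Alice holds qubits $A,A'$, Bob holds qubits $B,B'$ and a third party, the Bank, holds a qubit $K$; the joint state is $$|\Psi_0\rangle=(\cos\theta\,|00\rangle+\sin\theta\,|11\rangle)_{AB}\otimes(\alpha|000\rangle+\beta|111\rangle)_{A'B'K}.$$ Say that a state shared by Alice and Bob can be deterministically restored if some LOCC protocol between them (finitely many rounds; in each round one party performs a finite-outcome generalized measurement on their local system, which may change its finite dimension, and announces the outcome) maps it exactly to $|\Phi^+\rangle\langle\Phi^+|_{AB}$, where $|\Phi^+\rangle=\tfrac1{\sqrt2}(|00\rangle+|11\rangle)$ and all other registers are discarded. In the Bank-measures model the Bank performs a measurement on $K$ with a one-bit outcome $m$ (operators $M_0,M_1$ on $K$ with $M_0^\dagger M_0+M_1^\dagger M_1=I$) and broadcasts $m$; deterministic restoration is possible if for every $m$ of nonzero probability the normalized conditional state of $AA'\mid BB'$ can be deterministically restored, by a protocol that may depend on $m$. In the transfer model the qubit $K$ is given to Alice; deterministic restoration is possible if $|\Psi_0\rangle$, shared as $AA'K\mid BB'$,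 can be deterministically restored. Then the following are each equivalent to $$\alpha^2\le\frac{1}{2\cos^2\theta}:$$ 1. deterministic restoration is possible in the Bank-measures model when the Bank measures $K$ in the Hadamard basis $\{|+\rangle,|-\rangle\}$; 2. deterministic restoration is possible in the Bank-measures model for some one-bit measurement of $K$ by the Bank; 3. deterministic restoration is possible in the transfer model. -/

import Mathlib

open scoped Matrix Kronecker

noncomputable section

namespace AssistedTeleportation

/-- The computational basis labels of one qubit; a system with basis labels `S` has the state
space `S → ℂ`, and its density operators are matrices indexed by `S`. -/
abbrev Qubit : Type := Fin 2

/-- The density operator `|ψ⟩⟨ψ|` of a ket. -/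
def pureState {S : Type} (ψ : S → ℂ) : Matrix S S ℂ :=
  Matrix.vecMulVec ψ (star ψ)

/-- The partial trace over the second tensor factor. -/
def traceOutRight {S K : Type} [Fintype K] (ρ : Matrix (S × K) (S × K) ℂ) : Matrix S S ℂ :=
  Matrix.of fun i j => ∑ k, ρ (i, k) (j, k)

/-- `IsLOCC Λ`: the map `Λ`, from operators on Alice's system `A` and Bob's system `B` to operators
on Alice's system `A'` and Bob's system `B'`, is realised by an LOCC protocol with finitely many
rounds. In each round one party performs a generalized measurement on all of their local system,
with finitely many outcomes `i` and Kraus operators `M i` satisfying `∑ i, (M i)ᴴ * M i = 1`, and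
announces the outcome, on which everything that follows may depend. The local system after the
measurement may be any finite-dimensional one, so that local unitaries, local ancillas of any size,
shared randomness, and the discarding of local subsystems (measure them and ignore the outcome)
are included. The operator `Λ ρ` is the average over all branches. -/
inductive IsLOCC {A' B' : Type} [Fintype A'] [DecidableEq A'] [Fintype B'] [DecidableEq B'] :
    ∀ {A B : Type} [Fintype A] [DecidableEq A] [Fintype B] [DecidableEq B],
      (Matrix (A × B) (A × B) ℂ → Matrix (A' × B') (A' × B') ℂ) → Prop
  /-- The protocol stops. -/
  | stop_here : IsLOCC (A := A') (B := B') fun ρ => ρ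
  /-- Alice measures and announces the outcome. -/
  | alice {A B : Type} [Fintype A] [DecidableEq A] [Fintype B] [DecidableEq B]
      {n : ℕ} {C : Fin n → Type} [∀ i, Fintype (C i)] [∀ i, DecidableEq (C i)]
      (M : ∀ i, Matrix (C i) A ℂ) (hM : ∑ i, (M i)ᴴ * M i = 1)
      (Λ : ∀ i, Matrix (C i × B) (C i × B) ℂ → Matrix (A' × B') (A' × B') ℂ)
      (hΛ : ∀ i, IsLOCC (Λ i)) :
      IsLOCC (A := A) (B := B) fun ρ =>
        ∑ i, Λ i ((M i ⊗ₖ (1 : Matrix B B ℂ)) * ρ * (M i ⊗ₖ (1 : Matrix B B ℂ))ᴴ)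
  /-- Bob measures and announces the outcome. -/
  | bob {A B : Type} [Fintype A] [DecidableEq A] [Fintype B] [DecidableEq B]
      {n : ℕ} {C : Fin n → Type} [∀ i, Fintype (C i)] [∀ i, DecidableEq (C i)]
      (M : ∀ i, Matrix (C i) B ℂ) (hM : ∑ i, (M i)ᴴ * M i = 1)
      (Λ : ∀ i, Matrix (A × C i) (A × C i) ℂ → Matrix (A' × B') (A' × B') ℂ)
      (hΛ : ∀ i, IsLOCC (Λ i)) :
      IsLOCC (A := A) (B := B) fun ρ =>
        ∑ i, Λ i (((1 : Matrix A A ℂ) ⊗ₖ M i) * ρ * ((1 : Matrix A A ℂ) ⊗ₖ M i)ᴴ)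

/-- The imperfect link `cos θ |00⟩ + sin θ |11⟩` on `AB`. -/
def linkKet (θ : ℝ) : Qubit × Qubit → ℂ :=
  Pi.single (0, 0) (Real.cos θ : ℂ) + Pi.single (1, 1) (Real.sin θ : ℂ)

/-- The Bank state `α |000⟩ + β |111⟩` on `A'B'K`. -/
def ghzKet (α β : ℝ) : Qubit × Qubit × Qubit → ℂ :=
  Pi.single (0, 0, 0) (α : ℂ) + Pi.single (1, 1, 1) (β : ℂ)

/-- The Bell state `(|00⟩ + |11⟩) / √2`. -/
def bellKet : Qubit × Qubit → ℂ :=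
  Pi.single (0, 0) ((1 / √2 : ℝ) : ℂ) + Pi.single (1, 1) ((1 / √2 : ℝ) : ℂ)

/-- The density operator of the Bell state on `AB`. -/
def bellState : Matrix (Qubit × Qubit) (Qubit × Qubit) ℂ := pureState bellKet

/-- LOCC converts the state `ρ` shared by Alice and Bob into a perfect Bell pair on `AB`,
with certainty and exactly, all other registers being discarded. -/
def CanRestoreBell {S T : Type} [Fintype S] [DecidableEq S] [Fintype T] [DecidableEq T]
    (ρ : Matrix (S × T) (S × T) ℂ) : Prop :=
  ∃ Λ : Matrix (S × T) (S × T) ℂ → Matrix (Qubit × Qubit) (Qubit × Qubit) ℂ,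
    IsLOCC Λ ∧ Λ ρ = bellState

/-- The initial state `ψ(θ)_{AB} ⊗ Φ_{A'B'K}`, with `K` at the Bank: the registers are ordered as
`((A, A'), (B, B')), K`. -/
def initialKet (θ α β : ℝ) : ((Qubit × Qubit) × (Qubit × Qubit)) × Qubit → ℂ :=
  fun (((a, a'), (b, b')), k) => linkKet θ (a, b) * ghzKet α β (a', b', k)

/-- The same state after `K` has been handed to Alice: the registers are ordered as
`(A, A', K), (B, B')`. -/
def transferKet (θ α β : ℝ) : (Qubit × Qubit × Qubit) × (Qubit × Qubit) → ℂ :=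
  fun ((a, a', k), (b, b')) => linkKet θ (a, b) * ghzKet α β (a', b', k)

/-- A generalized measurement of the qubit `K` with a one-bit outcome. -/
structure BinaryMeasurement where
  op : Fin 2 → Matrix Qubit Qubit ℂ
  complete : ∑ m, (op m)ᴴ * op m = 1

/-- The Hadamard basis `|+⟩, |-⟩`. -/
def hadamardKet (m : Fin 2) : Qubit → ℂ :=
  fun k => if m = 1 ∧ k = 1 then -((1 / √2 : ℝ) : ℂ) else ((1 / √2 : ℝ) : ℂ)

/-- The projective measurement in the Hadamard basis. -/
def hadamardMeasurement : BinaryMeasurement where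
  op m := pureState (hadamardKet m)
  complete := by
    have h : ((√2 : ℝ) : ℂ) ^ 2 = 2 := by
      rw [← Complex.ofReal_pow, Real.sq_sqrt (by norm_num)]; norm_num
    have h0 : ((√2 : ℝ) : ℂ) ≠ 0 := by
      intro h'; rw [h'] at h; norm_num at h
    have h4 : ((√2 : ℝ) : ℂ) ^ 4 = 4 := by
      rw [show (4 : ℕ) = 2 * 2 from rfl, pow_mul, h]; norm_num
    ext i j
    fin_cases i <;> fin_cases j <;>
      simp [pureState, hadamardKet, Matrix.mul_apply, Matrix.vecMulVec_apply,
        Fin.sum_univ_two] <;> field_simp <;> norm_num [h, h4]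

/-- The unnormalized state of `AA'` and `BB'` when the Bank has measured `K` with outcome `m`;
its trace is the probability of that outcome. -/
def branchState (θ α β : ℝ) (M : BinaryMeasurement) (m : Fin 2) :
    Matrix ((Qubit × Qubit) × (Qubit × Qubit)) ((Qubit × Qubit) × (Qubit × Qubit)) ℂ :=
  traceOutRight (((1 : Matrix _ _ ℂ) ⊗ₖ M.op m) * pureState (initialKet θ α β) *
    ((1 : Matrix _ _ ℂ) ⊗ₖ M.op m)ᴴ)

/-- Bank-measures model with the measurement `M`: the Bank measures `K` and broadcasts the one-bit
outcome, after which Alice and Bob act by LOCC. Deterministic restoration means that they obtain a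
perfect Bell pair for every outcome that can occur; their protocol may depend on the outcome. -/
def BankMeasuresFeasible (θ α β : ℝ) (M : BinaryMeasurement) : Prop :=
  ∀ m, (branchState θ α β M m).trace ≠ 0 →
    CanRestoreBell ((branchState θ α β M m).trace⁻¹ • branchState θ α β M m)

/-- Transfer model: `K` is handed to Alice, after which Alice and Bob act by LOCC. -/
def TransferFeasible (θ α β : ℝ) : Prop :=
  CanRestoreBell (pureState (transferKet θ α β))

end AssistedTeleportation

end

namespace AssistedTeleportation

open scoped ComplexOrder

/-! All three conditions reduce to one inequality: the largest squared Schmidt coefficient of the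
initial state in the cut `AA'K | BB'`, namely `α² cos² θ`, is at most `1/2`.

Necessity. Write a pure state as a coefficient matrix `X`; Alice acts by `M * X`, Bob by `X * Mᵀ`. A
pure state is an extreme point (`exists_smul_pureState_of_sum_eq`), so if a protocol ends in a
multiple `c` of the Bell state, each branch ends in a multiple `r i` of it, with `∑ r i = c`. At a
leaf the overlap with unit product kets is at most `r i / 2`, and completeness of the measurements
adds these bounds back up the protocol tree (`IsLOCC.productOverlapLE`). Overlaps with basis kets
then bound single entries. Summed over the Bank's outcomes, the entry bounds no longer depend on the
measurement.

Sufficiency. A Hadamard outcome on `K` leaves a pure state with the same Schmidt weights up to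
normalization. When none exceeds half of the total, they are the vertex degrees of a nonnegative
edge weighting of a graph on the four labels. Alice's measurement selects an edge and equalizes its
two amplitudes, which leaves a Bell pair (`exists_isLOCC_diagonal_eq`). In the transfer model Alice
performs the Hadamard measurement herself. -/

/-! ### Kets and local operators -/

/-- The bipartite ket whose coefficient matrix is `X`. -/
def ketOf {A B : Type} (X : Matrix A B ℂ) : A × B → ℂ := fun p => X p.1 p.2

/-- The squared Euclidean norm of a ket. -/
noncomputable def ketNormSq {A : Type} [Fintype A] (v : A → ℂ) : ℝ := ∑ a, ‖v a‖ ^ 2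

lemma ketNormSq_nonneg {A : Type} [Fintype A] (v : A → ℂ) : 0 ≤ ketNormSq v :=
  Finset.sum_nonneg fun _ _ => by positivity

lemma ofReal_ketNormSq {A : Type} [Fintype A] (v : A → ℂ) :
    (ketNormSq v : ℂ) = star v ⬝ᵥ v := by
  simp [ketNormSq, dotProduct, Complex.conj_mul']

lemma ketNormSq_star {A : Type} [Fintype A] (v : A → ℂ) : ketNormSq (star v) = ketNormSq v := by
  simp [ketNormSq]

lemma ketNormSq_single {A : Type} [Fintype A] [DecidableEq A] (a : A) :
    ketNormSq (Pi.single a (1 : ℂ)) = 1 := by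
  rw [ketNormSq, Finset.sum_eq_single a] <;> simp +contextual

lemma norm_dotProduct_sq_le {A : Type} [Fintype A] (u v : A → ℂ) :
    ‖u ⬝ᵥ v‖ ^ 2 ≤ ketNormSq u * ketNormSq v := by
  calc ‖u ⬝ᵥ v‖ ^ 2 ≤ (∑ a, ‖u a‖ * ‖v a‖) ^ 2 := by
        gcongr
        simpa only [dotProduct, norm_mul] using
          norm_sum_le Finset.univ fun a => u a * v a
    _ ≤ _ := Finset.sum_mul_sq_le_sq_mul_sq _ _ _

lemma sum_ketNormSq_mulVec {A : Type} [Fintype A] [DecidableEq A] {n : ℕ} {C : Fin n → Type}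
    [∀ i, Fintype (C i)] (M : ∀ i, Matrix (C i) A ℂ) (hM : ∑ i, (M i)ᴴ * M i = 1) (v : A → ℂ) :
    ∑ i, ketNormSq (M i *ᵥ v) = ketNormSq v := by
  apply Complex.ofReal_injective
  push_cast
  simp_rw [ofReal_ketNormSq, Matrix.star_mulVec, ← Matrix.dotProduct_mulVec, Matrix.mulVec_mulVec]
  rw [← dotProduct_sum, ← Matrix.sum_mulVec, hM, Matrix.one_mulVec]

lemma mul_pureState_mul_conjTranspose {S T : Type} [Fintype S] (N : Matrix T S ℂ) (ψ : S → ℂ) :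
    N * pureState ψ * Nᴴ = pureState (N *ᵥ ψ) := by
  rw [pureState, pureState, Matrix.mul_vecMulVec, Matrix.vecMulVec_mul, Matrix.star_mulVec]

lemma pureState_smul {S : Type} (c : ℂ) (ψ : S → ℂ) :
    pureState (c • ψ) = (c * star c) • pureState ψ := by
  ext i j
  simp [pureState, Matrix.vecMulVec_apply]
  ring

lemma kronecker_one_mulVec_ketOf {A B C : Type} [Fintype A] [Fintype B] [DecidableEq B]
    (M : Matrix C A ℂ) (X : Matrix A B ℂ) :
    (M ⊗ₖ (1 : Matrix B B ℂ)) *ᵥ ketOf X = ketOf (M * X) := by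
  ext ⟨c, b⟩
  simp [ketOf, Matrix.mulVec, dotProduct, Fintype.sum_prod_type, Matrix.one_apply, Matrix.mul_apply]

lemma one_kronecker_mulVec_ketOf {A B C : Type} [Fintype A] [Fintype B] [DecidableEq A]
    (M : Matrix C B ℂ) (X : Matrix A B ℂ) :
    ((1 : Matrix A A ℂ) ⊗ₖ M) *ᵥ ketOf X = ketOf (X * Mᵀ) := by
  ext ⟨a, c⟩
  simp only [ketOf, Matrix.mulVec, dotProduct, Fintype.sum_prod_type, Matrix.kroneckerMap_apply,
    Matrix.one_apply, Matrix.mul_apply, Matrix.transpose_apply]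
  rw [Finset.sum_eq_single a]
  · simp [mul_comm]
  · intro b _ hb
    simp [hb.symm]
  · simp

/-! ### Structural properties of LOCC maps -/

lemma IsLOCC.isLinearMap {A' B' : Type} [Fintype A'] [DecidableEq A'] [Fintype B'] [DecidableEq B']
    {A B : Type} [Fintype A] [DecidableEq A] [Fintype B] [DecidableEq B]
    {Λ : Matrix (A × B) (A × B) ℂ → Matrix (A' × B') (A' × B') ℂ} (h : IsLOCC Λ) :
    IsLinearMap ℂ Λ := by
  induction h with
  | stop_here => exact ⟨fun _ _ => rfl, fun _ _ => rfl⟩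
  | alice M hM Λ hΛ ih =>
    refine ⟨fun x y => ?_, fun c x => ?_⟩
    · simp only [Matrix.mul_add, Matrix.add_mul, (ih _).map_add, Finset.sum_add_distrib]
    · simp only [Matrix.mul_smul, Matrix.smul_mul, (ih _).map_smul, Finset.smul_sum]
  | bob M hM Λ hΛ ih =>
    refine ⟨fun x y => ?_, fun c x => ?_⟩
    · simp only [Matrix.mul_add, Matrix.add_mul, (ih _).map_add, Finset.sum_add_distrib]
    · simp only [Matrix.mul_smul, Matrix.smul_mul, (ih _).map_smul, Finset.smul_sum]

lemma IsLOCC.map_sum {A' B' : Type} [Fintype A'] [DecidableEq A'] [Fintype B'] [DecidableEq B']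
    {A B : Type} [Fintype A] [DecidableEq A] [Fintype B] [DecidableEq B]
    {Λ : Matrix (A × B) (A × B) ℂ → Matrix (A' × B') (A' × B') ℂ} (h : IsLOCC Λ)
    {ι : Type} [Fintype ι] (ρ : ι → Matrix (A × B) (A × B) ℂ) :
    Λ (∑ i, ρ i) = ∑ i, Λ (ρ i) :=
  _root_.map_sum (h.isLinearMap.mk' Λ) ρ Finset.univ

lemma IsLOCC.posSemidef {A' B' : Type} [Fintype A'] [DecidableEq A'] [Fintype B'] [DecidableEq B']
    {A B : Type} [Fintype A] [DecidableEq A] [Fintype B] [DecidableEq B]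
    {Λ : Matrix (A × B) (A × B) ℂ → Matrix (A' × B') (A' × B') ℂ} (h : IsLOCC Λ)
    {ρ : Matrix (A × B) (A × B) ℂ} (hρ : ρ.PosSemidef) : (Λ ρ).PosSemidef := by
  induction h with
  | stop_here => exact hρ
  | alice M hM Λ hΛ ih =>
    exact Matrix.posSemidef_sum _ fun i _ => ih i (hρ.mul_mul_conjTranspose_same _)
  | bob M hM Λ hΛ ih =>
    exact Matrix.posSemidef_sum _ fun i _ => ih i (hρ.mul_mul_conjTranspose_same _)

lemma posSemidef_pureState {S : Type} [Finite S] (ψ : S → ℂ) : (pureState ψ).PosSemidef :=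
  Matrix.posSemidef_vecMulVec_self_star ψ

/-- A pure state is extremal: positive operators summing to a multiple of it are multiples of it. -/
lemma exists_smul_pureState_of_sum_eq {S ι : Type} [Fintype S] [DecidableEq S] [Fintype ι]
    {φ : S → ℂ} (hφ : star φ ⬝ᵥ φ = 1) {P : ι → Matrix S S ℂ} (hP : ∀ i, (P i).PosSemidef)
    {c : ℝ} (h : ∑ i, P i = (c : ℂ) • pureState φ) :
    ∃ r : ι → ℝ, (∀ i, 0 ≤ r i) ∧ (∀ i, P i = (r i : ℂ) • pureState φ) ∧ ∑ i, r i = c := by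
  -- On the orthogonal complement of `φ` the nonnegative quadratic forms of the `P i` sum to zero,
  -- so each vanishes there. Hermiticity then compresses `P i` to the line of `φ` from both sides.
  have hker : ∀ i x, star φ ⬝ᵥ x = 0 → P i *ᵥ x = 0 := by
    intro i x hx
    rw [← (hP i).dotProduct_mulVec_zero_iff]
    have hsum : ∑ j, star x ⬝ᵥ P j *ᵥ x = 0 := by
      rw [← dotProduct_sum, ← Matrix.sum_mulVec, h, pureState, Matrix.smul_mulVec,
        Matrix.vecMulVec_mulVec, hx]
      simp
    exact (Finset.sum_eq_zero_iff_of_nonneg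
      fun j _ => (hP j).dotProduct_mulVec_nonneg x).1 hsum i (Finset.mem_univ i)
  have hmul : ∀ i, P i = P i * pureState φ := by
    intro i
    refine Matrix.ext_of_mulVec_single fun j => ?_
    have := hker i (Pi.single j 1 - pureState φ *ᵥ Pi.single j 1) (by
      rw [dotProduct_sub, pureState, Matrix.vecMulVec_mulVec]
      simp [hφ])
    rw [Matrix.mulVec_sub, sub_eq_zero, Matrix.mulVec_mulVec] at this
    exact this
  have hherm : (pureState φ)ᴴ = pureState φ := (posSemidef_pureState φ).1
  have hscal : ∀ i, P i = (star φ ⬝ᵥ P i *ᵥ φ) • pureState φ := by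
    intro i
    have h1 : P i = pureState φ * P i := by
      have := congrArg Matrix.conjTranspose (hmul i)
      rwa [Matrix.conjTranspose_mul, (hP i).1, hherm] at this
    have h2 : P i = pureState φ * P i * pureState φ := by
      rw [← h1]; exact hmul i
    conv_lhs => rw [h2]
    rw [pureState, Matrix.vecMulVec_mul, Matrix.vecMulVec_mul_vecMulVec,
      Matrix.dotProduct_mulVec, Matrix.vecMulVec_smul]
  have hre : ∀ i, (((star φ ⬝ᵥ P i *ᵥ φ).re : ℝ) : ℂ) = star φ ⬝ᵥ P i *ᵥ φ := fun i =>
    (Complex.eq_re_of_ofReal_le ((hP i).dotProduct_mulVec_nonneg φ)).symm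
  refine ⟨fun i => (star φ ⬝ᵥ P i *ᵥ φ).re, fun i => ?_, fun i => ?_, ?_⟩
  · exact (Complex.nonneg_iff.1 ((hP i).dotProduct_mulVec_nonneg φ)).1
  · simp only [hre]
    exact hscal i
  · apply Complex.ofReal_injective
    push_cast
    simp only [hre]
    rw [← dotProduct_sum, ← Matrix.sum_mulVec, h, pureState, Matrix.smul_mulVec,
      Matrix.vecMulVec_mulVec]
    simp [hφ]

/-! ### The largest Schmidt coefficient does not decrease on average -/

lemma ofReal_inv_sqrt_two_mul_self : ((√2 : ℝ) : ℂ)⁻¹ * ((√2 : ℝ) : ℂ)⁻¹ = 2⁻¹ := by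
  rw [← mul_inv, ← Complex.ofReal_mul, Real.mul_self_sqrt (by norm_num)]
  norm_num

lemma bellKet_eq_ketOf : bellKet = ketOf (((√2 : ℝ) : ℂ)⁻¹ • (1 : Matrix Qubit Qubit ℂ)) := by
  ext ⟨i, j⟩
  fin_cases i <;> fin_cases j <;> simp [bellKet, ketOf]

lemma star_bellKet_dotProduct_bellKet : star bellKet ⬝ᵥ bellKet = 1 := by
  have h := ofReal_inv_sqrt_two_mul_self
  simp [bellKet_eq_ketOf, ketOf, dotProduct, Fintype.sum_prod_type, Fin.sum_univ_two, h]
  norm_num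

/-- The overlap of the ket with coefficient matrix `X` with every product ket is at most `c / 2`. -/
def ProductOverlapLE {A B : Type} [Fintype A] [Fintype B] (X : Matrix A B ℂ) (c : ℝ) : Prop :=
  ∀ u v, ‖u ⬝ᵥ X *ᵥ v‖ ^ 2 ≤ c / 2 * ketNormSq u * ketNormSq v

lemma ProductOverlapLE.transpose {A B : Type} [Fintype A] [Fintype B] {X : Matrix A B ℂ} {c : ℝ}
    (h : ProductOverlapLE X c) : ProductOverlapLE Xᵀ c := by
  intro u v
  have := h v u
  rw [Matrix.mulVec_transpose, dotProduct_comm, ← Matrix.dotProduct_mulVec]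
  linarith

lemma ProductOverlapLE.ketNormSq_mulVec_le {A B : Type} [Fintype A] [Fintype B] {X : Matrix A B ℂ}
    {c : ℝ} (hc : 0 ≤ c) (h : ProductOverlapLE X c) (v : B → ℂ) :
    ketNormSq (X *ᵥ v) ≤ c / 2 * ketNormSq v := by
  -- The optimal `u` gives `‖Xv‖⁴ ≤ (c/2) ‖Xv‖² ‖v‖²`; one factor cancels unless `Xv = 0`.
  have h1 := h (star (X *ᵥ v)) v
  rw [← ofReal_ketNormSq, ketNormSq_star, Complex.norm_real, Real.norm_eq_abs, sq_abs] at h1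
  rcases (ketNormSq_nonneg (X *ᵥ v)).eq_or_lt with h0 | h0
  · rw [← h0]
    have := ketNormSq_nonneg v
    positivity
  · nlinarith

/-- Completeness splits `‖Xv‖²` into the sum of the `‖M i X v‖²`, so the branch bounds add;
Cauchy-Schwarz brings `u` back. -/
lemma ProductOverlapLE.of_measurement {A B : Type} [Fintype A] [DecidableEq A] [Fintype B]
    {n : ℕ} {C : Fin n → Type} [∀ i, Fintype (C i)]
    {M : ∀ i, Matrix (C i) A ℂ} (hM : ∑ i, (M i)ᴴ * M i = 1) {X : Matrix A B ℂ} {r : Fin n → ℝ}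
    (hr : ∀ i, 0 ≤ r i) (h : ∀ i, ProductOverlapLE (M i * X) (r i)) :
    ProductOverlapLE X (∑ i, r i) := by
  intro u v
  have h1 : ketNormSq (X *ᵥ v) ≤ (∑ i, r i) / 2 * ketNormSq v := by
    rw [← sum_ketNormSq_mulVec M hM, Finset.sum_div, Finset.sum_mul]
    refine Finset.sum_le_sum fun i _ => ?_
    rw [Matrix.mulVec_mulVec]
    exact (h i).ketNormSq_mulVec_le (hr i) v
  calc _ ≤ ketNormSq u * ketNormSq (X *ᵥ v) := norm_dotProduct_sq_le _ _
    _ ≤ ketNormSq u * ((∑ i, r i) / 2 * ketNormSq v) :=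
      mul_le_mul_of_nonneg_left h1 (ketNormSq_nonneg u)
    _ = _ := by ring

lemma dotProduct_pureState_mulVec_star {S : Type} [Fintype S] (ψ w : S → ℂ) :
    w ⬝ᵥ pureState ψ *ᵥ star w = ((‖w ⬝ᵥ ψ‖ ^ 2 : ℝ) : ℂ) := by
  have h : star ψ ⬝ᵥ star w = star (w ⬝ᵥ ψ) := by rw [Matrix.star_dotProduct_star]
  rw [pureState, Matrix.vecMulVec_mulVec, dotProduct_smul, h]
  simp [Complex.mul_conj']

lemma dotProduct_mulVec_eq_ketOf {A B : Type} [Fintype A] [Fintype B] (X : Matrix A B ℂ)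
    (u : A → ℂ) (v : B → ℂ) :
    u ⬝ᵥ X *ᵥ v = (fun p : A × B => u p.1 * v p.2) ⬝ᵥ ketOf X := by
  simp only [dotProduct, Matrix.mulVec, Fintype.sum_prod_type, ketOf, Finset.mul_sum]
  exact Finset.sum_congr rfl fun a _ => Finset.sum_congr rfl fun b _ => by ring

lemma productOverlapLE_of_pureState_eq {X : Matrix Qubit Qubit ℂ} {c : ℝ} (hc : 0 ≤ c)
    (h : pureState (ketOf X) = (c : ℂ) • bellState) : ProductOverlapLE X c := by
  intro u v
  have key : ‖u ⬝ᵥ X *ᵥ v‖ ^ 2 = c / 2 * ‖u ⬝ᵥ v‖ ^ 2 := by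
    apply Complex.ofReal_injective
    rw [dotProduct_mulVec_eq_ketOf, ← dotProduct_pureState_mulVec_star, h, Matrix.smul_mulVec,
      dotProduct_smul, bellState, dotProduct_pureState_mulVec_star, bellKet_eq_ketOf,
      ← dotProduct_mulVec_eq_ketOf, Matrix.smul_mulVec, Matrix.one_mulVec, dotProduct_smul,
      smul_eq_mul, smul_eq_mul, norm_mul, mul_pow, ← Complex.ofReal_mul]
    congr 1
    rw [norm_inv, Complex.norm_real, Real.norm_eq_abs, inv_pow, sq_abs, Real.sq_sqrt (by norm_num)]
    ring
  rw [key, mul_assoc]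
  exact mul_le_mul_of_nonneg_left (norm_dotProduct_sq_le u v) (by positivity)

/-- If a pure state becomes a multiple of the Bell state by LOCC, its largest Schmidt coefficient is
at most that of the outcome. -/
lemma IsLOCC.productOverlapLE {A B : Type} [Fintype A] [DecidableEq A] [Fintype B] [DecidableEq B]
    {Λ : Matrix (A × B) (A × B) ℂ → Matrix (Qubit × Qubit) (Qubit × Qubit) ℂ} (h : IsLOCC Λ)
    {X : Matrix A B ℂ} {c : ℝ} (hc : 0 ≤ c)
    (hX : Λ (pureState (ketOf X)) = (c : ℂ) • bellState) : ProductOverlapLE X c := by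
  induction h generalizing c with
  | stop_here => exact productOverlapLE_of_pureState_eq hc hX
  | alice M hM Λ hΛ ih =>
    simp only [mul_pureState_mul_conjTranspose, kronecker_one_mulVec_ketOf] at hX
    obtain ⟨r, hr, hP, rfl⟩ := exists_smul_pureState_of_sum_eq star_bellKet_dotProduct_bellKet
      (fun i => (hΛ i).posSemidef (posSemidef_pureState _)) hX
    exact .of_measurement hM hr fun i => ih i (hr i) (hP i)
  | bob M hM Λ hΛ ih =>
    simp only [mul_pureState_mul_conjTranspose, one_kronecker_mulVec_ketOf] at hX
    obtain ⟨r, hr, hP, rfl⟩ := exists_smul_pureState_of_sum_eq star_bellKet_dotProduct_bellKet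
      (fun i => (hΛ i).posSemidef (posSemidef_pureState _)) hX
    -- Transposition exchanges the parties and reduces Bob's round to the estimate for Alice's.
    rw [← Matrix.transpose_transpose X]
    refine (ProductOverlapLE.of_measurement hM hr fun i => ?_).transpose
    have := (ih i (hr i) (hP i)).transpose
    rwa [Matrix.transpose_mul, Matrix.transpose_transpose] at this

/-- The ensemble form is needed because a general operator of the Bank leaves a mixed state. By
linearity and extremality each member goes to a multiple of the Bell state, and the pure bounds add.
-/
lemma IsLOCC.sum_norm_sq_entry_le {A B ι : Type} [Fintype A] [DecidableEq A] [Fintype B]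
    [DecidableEq B] [Fintype ι]
    {Λ : Matrix (A × B) (A × B) ℂ → Matrix (Qubit × Qubit) (Qubit × Qubit) ℂ} (h : IsLOCC Λ)
    {X : ι → Matrix A B ℂ} {c : ℝ}
    (hX : Λ (∑ k, pureState (ketOf (X k))) = (c : ℂ) • bellState) (a : A) (b : B) :
    ∑ k, ‖X k a b‖ ^ 2 ≤ c / 2 := by
  rw [h.map_sum] at hX
  obtain ⟨r, hr, hP, rfl⟩ := exists_smul_pureState_of_sum_eq star_bellKet_dotProduct_bellKet
    (fun i => h.posSemidef (posSemidef_pureState _)) hX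
  rw [Finset.sum_div]
  refine Finset.sum_le_sum fun k _ => ?_
  simpa [ketNormSq_single] using
    h.productOverlapLE (hr k) (hP k) (Pi.single a 1) (Pi.single b 1)

/-! ### Preparing a Bell pair from a state in Schmidt form -/

lemma pureState_ketOf_smul_one (c : ℝ) :
    pureState (ketOf ((c : ℂ) • (1 : Matrix Qubit Qubit ℂ))) =
      ((2 * c ^ 2 : ℝ) : ℂ) • bellState := by
  have h : ketOf ((c : ℂ) • (1 : Matrix Qubit Qubit ℂ)) = ((c * √2 : ℝ) : ℂ) • bellKet := by
    have h2 : ((√2 : ℝ) : ℂ) ≠ 0 := by simp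
    rw [bellKet_eq_ketOf]
    ext p
    simp [ketOf]
    field_simp
  rw [h, pureState_smul, bellState]
  congr 1
  rw [Complex.star_def, Complex.conj_ofReal, ← Complex.ofReal_mul]
  congr 1
  rw [mul_mul_mul_comm, Real.mul_self_sqrt (by norm_num)]
  ring

/-- If the Schmidt weights `s t ^ 2` are the degrees of an edge weighting `w` of the complete graph
on the Schmidt labels, then LOCC turns the state into a Bell pair. Edge `e` joins `g e (0, 0)` and
`g e (0, 1)`. -/
lemma exists_isLOCC_diagonal_eq_of_weights {n : ℕ} (s : Qubit × Qubit → ℝ) (hs : ∀ t, s t ≠ 0)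
    (g : Fin n → Qubit × Qubit ≃ Qubit × Qubit) (w : Fin n → ℝ) (hw : ∀ e, 0 ≤ w e)
    (hdeg : ∀ t, ∑ e, ∑ q, (if g e (0, q) = t then w e else 0) = s t ^ 2) :
    ∃ Λ : Matrix ((Qubit × Qubit) × (Qubit × Qubit)) ((Qubit × Qubit) × (Qubit × Qubit)) ℂ →
        Matrix (Qubit × Qubit) (Qubit × Qubit) ℂ,
      IsLOCC Λ ∧ Λ (pureState (ketOf (Matrix.diagonal fun t => (s t : ℂ)))) =
        ((∑ t, s t ^ 2 : ℝ) : ℂ) • bellState := by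
  -- Dividing by `s t` gives both ends of edge `e` the amplitude `√(w e)`; completeness is exactly
  -- the degree condition `hdeg`.
  let M : Fin n → Matrix Qubit (Qubit × Qubit) ℂ := fun e =>
    Matrix.of fun q t => if g e (0, q) = t then ((√(w e) / s t : ℝ) : ℂ) else 0
  -- Bob relabels the ends of the edge as a qubit. His outcome `r = 1` only completes the
  -- measurement: his label agrees with Alice's, so that branch is zero.
  let K : Fin n → Fin 2 → Matrix Qubit (Qubit × Qubit) ℂ := fun e r =>
    Matrix.of fun q t => if g e (r, q) = t then 1 else 0
  have hM : ∑ e, (M e)ᴴ * M e = 1 := by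
    ext t t'
    simp only [Matrix.sum_apply, Matrix.mul_apply, Matrix.conjTranspose_apply, M, Matrix.of_apply,
      Matrix.one_apply]
    split_ifs with htt
    · subst htt
      have h : ∀ e q, star (if g e (0, q) = t then ((√(w e) / s t : ℝ) : ℂ) else 0) *
          (if g e (0, q) = t then ((√(w e) / s t : ℝ) : ℂ) else 0) =
          (((if g e (0, q) = t then w e else 0) / s t ^ 2 : ℝ) : ℂ) := by
        intro e q
        split_ifs
        · rw [Complex.star_def, Complex.conj_ofReal, ← Complex.ofReal_mul, div_mul_div_comm,
            Real.mul_self_sqrt (hw e), sq]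
        · simp
      simp only [h, ← Complex.ofReal_sum, ← Finset.sum_div, hdeg]
      rw [div_self (pow_ne_zero 2 (hs t)), Complex.ofReal_one]
    · refine Finset.sum_eq_zero fun e _ => Finset.sum_eq_zero fun q _ => ?_
      by_cases h : g e (0, q) = t
      · rw [if_neg (fun h' => htt (h.symm.trans h')), mul_zero]
      · rw [if_neg h, star_zero, zero_mul]
  have hK : ∀ e, ∑ r, (K e r)ᴴ * K e r = 1 := by
    intro e
    ext t t'
    simp only [Matrix.sum_apply, Matrix.mul_apply, Matrix.conjTranspose_apply, K, Matrix.of_apply,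
      Matrix.one_apply]
    rw [← Fintype.sum_prod_type (f := fun x : Qubit × Qubit =>
      star (if g e x = t then (1 : ℂ) else 0) * if g e x = t' then 1 else 0),
      (g e).sum_comp fun x => star (if x = t then (1 : ℂ) else 0) * if x = t' then 1 else 0,
      Finset.sum_eq_single t] <;> simp +contextual
  have hMK : ∀ e r, M e * Matrix.diagonal (fun t => (s t : ℂ)) * (K e r)ᵀ =
      ((if r = 0 then √(w e) else 0 : ℝ) : ℂ) • (1 : Matrix Qubit Qubit ℂ) := by
    intro e r
    ext q q'
    rw [Matrix.mul_apply]
    simp only [Matrix.mul_diagonal, M, K, Matrix.of_apply, Matrix.transpose_apply]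
    rw [Finset.sum_eq_single (g e (0, q))]
    · have h0 : (s (g e (0, q)) : ℂ) ≠ 0 := by exact_mod_cast hs _
      obtain rfl | hq := eq_or_ne q q'
      · by_cases hr : r = 0 <;> simp [hr, h0]
      · simp [hq, hq.symm]
    · intro t _ ht
      simp [ht.symm]
    · simp
  -- The handshake identity: every edge has two ends.
  have hsum : ∑ t, s t ^ 2 = ∑ e, 2 * w e := by
    simp_rw [← hdeg]
    rw [Finset.sum_comm]
    refine Finset.sum_congr rfl fun e _ => ?_
    rw [Finset.sum_comm]
    simp
  refine ⟨_, .alice M hM _ fun e => .bob (K e) (hK e) _ fun r => .stop_here, ?_⟩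
  simp only [mul_pureState_mul_conjTranspose, kronecker_one_mulVec_ketOf,
    one_kronecker_mulVec_ketOf, hMK, pureState_ketOf_smul_one]
  rw [hsum, Complex.ofReal_sum, Finset.sum_smul]
  refine Finset.sum_congr rfl fun e _ => ?_
  simp only [apply_ite (fun x : ℝ => ((2 * x ^ 2 : ℝ) : ℂ) • bellState), Real.sq_sqrt (hw e)]
  simp

/-- Join `(1, 1)` to `(0, 0)` only, which forces the weight `s (1, 1) ^ 2`. The remaining degrees on
the triangle `(0, 0)`, `(0, 1)`, `(1, 0)` determine its three weights, and the three inequalities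
say that these are nonnegative. -/
lemma exists_isLOCC_diagonal_eq (s : Qubit × Qubit → ℝ) (hs : ∀ t, s t ≠ 0)
    (h01 : s (1, 1) ^ 2 + s (1, 0) ^ 2 ≤ s (0, 0) ^ 2 + s (0, 1) ^ 2)
    (h10 : s (1, 1) ^ 2 + s (0, 1) ^ 2 ≤ s (0, 0) ^ 2 + s (1, 0) ^ 2)
    (h00 : s (0, 0) ^ 2 ≤ s (0, 1) ^ 2 + s (1, 0) ^ 2 + s (1, 1) ^ 2) :
    ∃ Λ : Matrix ((Qubit × Qubit) × (Qubit × Qubit)) ((Qubit × Qubit) × (Qubit × Qubit)) ℂ →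
        Matrix (Qubit × Qubit) (Qubit × Qubit) ℂ,
      IsLOCC Λ ∧ Λ (pureState (ketOf (Matrix.diagonal fun t => (s t : ℂ)))) =
        ((∑ t, s t ^ 2 : ℝ) : ℂ) • bellState := by
  refine exists_isLOCC_diagonal_eq_of_weights s hs
    ![Equiv.swap (0, 1) (1, 1), Equiv.refl _, Equiv.swap (0, 1) (1, 0), Equiv.swap (0, 0) (1, 0)]
    ![s (1, 1) ^ 2, (s (0, 0) ^ 2 - s (1, 1) ^ 2 + s (0, 1) ^ 2 - s (1, 0) ^ 2) / 2,
      (s (0, 0) ^ 2 - s (1, 1) ^ 2 + s (1, 0) ^ 2 - s (0, 1) ^ 2) / 2,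
      (s (0, 1) ^ 2 + s (1, 0) ^ 2 + s (1, 1) ^ 2 - s (0, 0) ^ 2) / 2] ?_ ?_
  · intro e
    fin_cases e
    · exact sq_nonneg _
    all_goals simp; linarith
  · rintro ⟨i, j⟩
    fin_cases i <;> fin_cases j <;>
      simp [Fin.sum_univ_four, Fin.sum_univ_two, Equiv.swap_apply_def] <;> ring

/-! ### The states of the two models -/

/-- The amplitude of the initial state at `|t⟩_{AA'} |t⟩_{BB'} |t.2⟩_K`. -/
noncomputable def schmidtAmplitude (θ α β : ℝ) (t : Qubit × Qubit) : ℝ :=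
  ![Real.cos θ, Real.sin θ] t.1 * ![α, β] t.2

lemma linkKet_mul_ghzKet (θ α β : ℝ) (a a' b b' k : Qubit) :
    linkKet θ (a, b) * ghzKet α β (a', b', k) =
      if k = a' then (if (a, a') = (b, b') then (schmidtAmplitude θ α β (a, a') : ℂ) else 0)
      else 0 := by
  fin_cases a <;> fin_cases a' <;> fin_cases b <;> fin_cases b' <;> fin_cases k <;>
    simp [linkKet, ghzKet, schmidtAmplitude]

lemma sum_schmidtAmplitude_sq {θ α β : ℝ} (h : α ^ 2 + β ^ 2 = 1) :
    ∑ t, schmidtAmplitude θ α β t ^ 2 = 1 := by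
  have := Real.cos_sq_add_sin_sq θ
  simp only [Fintype.sum_prod_type, Fin.sum_univ_two, schmidtAmplitude, Matrix.cons_val_zero,
    Matrix.cons_val_one]
  linear_combination (α ^ 2 + β ^ 2) * this + h

/-- The coefficient matrix of the state of `AA'` and `BB'` after the functional with coefficients `N`
has been applied to the register `K`. -/
noncomputable def branchMatrix (θ α β : ℝ) (N : Qubit → ℂ) :
    Matrix (Qubit × Qubit) (Qubit × Qubit) ℂ :=
  Matrix.diagonal fun t => (schmidtAmplitude θ α β t : ℂ) * N t.2

/-- Tracing out `K` after the measurement yields one pure term per row of the operator. -/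
lemma branchState_eq_sum (θ α β : ℝ) (M : BinaryMeasurement) (m : Fin 2) :
    branchState θ α β M m = ∑ k, pureState (ketOf (branchMatrix θ α β (M.op m k))) := by
  have h : ∀ i k, (((1 : Matrix _ _ ℂ) ⊗ₖ M.op m) *ᵥ initialKet θ α β) (i, k) =
      ketOf (branchMatrix θ α β (M.op m k)) i := by
    rintro ⟨⟨a, a'⟩, ⟨b, b'⟩⟩ k
    change (((1 : Matrix _ _ ℂ) ⊗ₖ M.op m) *ᵥ
      ketOf (Matrix.of fun i k => initialKet θ α β (i, k))) _ = _
    rw [one_kronecker_mulVec_ketOf]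
    simp [ketOf, Matrix.mul_apply, initialKet, linkKet_mul_ghzKet, branchMatrix,
      Matrix.diagonal_apply]
  ext i j
  rw [branchState, mul_pureState_mul_conjTranspose, Matrix.sum_apply]
  simp only [traceOutRight, pureState, Matrix.of_apply, Matrix.vecMulVec_apply, Pi.star_apply, h]

lemma trace_branchState (θ α β : ℝ) (M : BinaryMeasurement) (m : Fin 2) :
    (branchState θ α β M m).trace =
      ((∑ k, ∑ t, ‖branchMatrix θ α β (M.op m k) t t‖ ^ 2 : ℝ) : ℂ) := by
  rw [branchState_eq_sum, Matrix.trace_sum, Complex.ofReal_sum]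
  refine Finset.sum_congr rfl fun k _ => ?_
  simp only [Matrix.trace, Matrix.diag_apply, pureState, Matrix.vecMulVec_apply, Pi.star_apply,
    Fintype.sum_prod_type (α₁ := Qubit × Qubit), ketOf, Complex.ofReal_sum]
  refine Finset.sum_congr rfl fun t _ => ?_
  rw [Finset.sum_eq_single t]
  · simp [Complex.mul_conj']
  · intro t' _ ht
    simp [branchMatrix, Matrix.diagonal_apply_ne _ ht.symm]
  · simp

lemma BinaryMeasurement.sum_norm_sq (M : BinaryMeasurement) (j : Qubit) :
    ∑ m, ∑ k, ‖M.op m k j‖ ^ 2 = 1 := by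
  apply Complex.ofReal_injective
  have := congrFun (congrFun M.complete j) j
  simpa [Matrix.sum_apply, Matrix.mul_apply, Complex.conj_mul'] using this

lemma sum_norm_sq_branchMatrix (θ α β : ℝ) (M : BinaryMeasurement) (t : Qubit × Qubit) :
    ∑ m, ∑ k, ‖branchMatrix θ α β (M.op m k) t t‖ ^ 2 = schmidtAmplitude θ α β t ^ 2 := by
  simp only [branchMatrix, Matrix.diagonal_apply_eq, norm_mul, mul_pow, Complex.norm_real,
    Real.norm_eq_abs, sq_abs, ← Finset.mul_sum, M.sum_norm_sq, mul_one]

/-! ### Necessity -/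

lemma BankMeasuresFeasible.schmidtAmplitude_sq_le {θ α β : ℝ} {M : BinaryMeasurement}
    (h : BankMeasuresFeasible θ α β M) (hnorm : α ^ 2 + β ^ 2 = 1) (t : Qubit × Qubit) :
    schmidtAmplitude θ α β t ^ 2 ≤ 1 / 2 := by
  have hm : ∀ m, ∑ k, ‖branchMatrix θ α β (M.op m k) t t‖ ^ 2 ≤
      (∑ k, ∑ t, ‖branchMatrix θ α β (M.op m k) t t‖ ^ 2) / 2 := by
    intro m
    by_cases h0 : (branchState θ α β M m).trace = 0
    -- An outcome of probability zero has only zero entries, so the bound is trivial there.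
    · rw [trace_branchState, Complex.ofReal_eq_zero] at h0
      rw [h0, zero_div, ← h0]
      exact Finset.sum_le_sum fun k _ => Finset.single_le_sum
        (f := fun t => ‖branchMatrix θ α β (M.op m k) t t‖ ^ 2)
        (fun _ _ => by positivity) (Finset.mem_univ t)
    · obtain ⟨Λ, hΛ, hbell⟩ := h m h0
      rw [hΛ.isLinearMap.map_smul, inv_smul_eq_iff₀ h0, trace_branchState,
        branchState_eq_sum] at hbell
      exact hΛ.sum_norm_sq_entry_le hbell t t
  calc schmidtAmplitude θ α β t ^ 2
      = ∑ m, ∑ k, ‖branchMatrix θ α β (M.op m k) t t‖ ^ 2 :=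
        (sum_norm_sq_branchMatrix θ α β M t).symm
    _ ≤ ∑ m, (∑ k, ∑ t, ‖branchMatrix θ α β (M.op m k) t t‖ ^ 2) / 2 :=
        Finset.sum_le_sum fun m _ => hm m
    _ = (∑ t, ∑ m, ∑ k, ‖branchMatrix θ α β (M.op m k) t t‖ ^ 2) / 2 := by
        rw [← Finset.sum_div, Finset.sum_comm (γ := Qubit × Qubit)]
        congr 1
        exact Finset.sum_congr rfl fun m _ => Finset.sum_comm
    _ = 1 / 2 := by
        simp only [sum_norm_sq_branchMatrix, sum_schmidtAmplitude_sq hnorm]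

/-- The coefficient matrix of the state of the transfer model. -/
noncomputable def transferMatrix (θ α β : ℝ) : Matrix (Qubit × Qubit × Qubit) (Qubit × Qubit) ℂ :=
  Matrix.of fun x y => transferKet θ α β (x, y)

lemma TransferFeasible.schmidtAmplitude_sq_le {θ α β : ℝ}
    (h : TransferFeasible θ α β) (t : Qubit × Qubit) :
    schmidtAmplitude θ α β t ^ 2 ≤ 1 / 2 := by
  obtain ⟨Λ, hΛ, hbell⟩ := h
  -- The state is pure, so the ensemble has one member. Alice's label is `(t.1, t.2, t.2)` because
  -- `K` copies `A'`.
  have := hΛ.sum_norm_sq_entry_le (ι := Unit) (X := fun _ => transferMatrix θ α β) (c := 1)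
    (by rw [Complex.ofReal_one, one_smul, ← hbell, Fintype.sum_unique]; rfl) (t.1, t.2, t.2) t
  simpa [transferMatrix, transferKet, linkKet_mul_ghzKet] using this

/-! ### Sufficiency -/

/-- The real coefficients of the Hadamard basis. -/
noncomputable def hadamardCoeff (m k : Fin 2) : ℝ := if m = 1 ∧ k = 1 then -(√2)⁻¹ else (√2)⁻¹

lemma hadamardKet_eq (m k : Fin 2) : hadamardKet m k = (hadamardCoeff m k : ℂ) := by
  simp only [hadamardKet, hadamardCoeff]
  split_ifs <;> simp

lemma hadamardCoeff_sq (m k : Fin 2) : hadamardCoeff m k ^ 2 = 1 / 2 := by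
  simp only [hadamardCoeff]
  split_ifs <;> simp

lemma sum_hadamardKet_mul (j k : Qubit) :
    ∑ m, star (hadamardKet m j) * hadamardKet m k = if j = k then 1 else 0 := by
  have h := ofReal_inv_sqrt_two_mul_self
  fin_cases j <;> fin_cases k <;> (simp [hadamardKet, h]; try norm_num)

lemma exists_isLOCC_hadamard_branch {θ α β : ℝ} (hθ : θ ∈ Set.Ioc 0 (Real.pi / 4)) (hβ : 0 < β)
    (hβα : β ≤ α) (hnorm : α ^ 2 + β ^ 2 = 1) (hle : α ^ 2 ≤ 1 / (2 * Real.cos θ ^ 2))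
    (m : Fin 2) :
    ∃ Λ : Matrix ((Qubit × Qubit) × (Qubit × Qubit)) ((Qubit × Qubit) × (Qubit × Qubit)) ℂ →
        Matrix (Qubit × Qubit) (Qubit × Qubit) ℂ,
      IsLOCC Λ ∧ Λ (pureState (ketOf (branchMatrix θ α β (hadamardKet m)))) =
        (1 / 2 : ℂ) • bellState := by
  obtain ⟨h0, h1⟩ := hθ
  have hpi := Real.pi_pos
  have hsin : 0 < Real.sin θ := Real.sin_pos_of_pos_of_lt_pi h0 (by linarith)
  have hcos : 0 < Real.cos θ := Real.cos_pos_of_mem_Ioo ⟨by linarith, by linarith⟩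
  have hsc : Real.sin θ ≤ Real.cos θ := by
    rw [← Real.cos_pi_div_two_sub]
    exact Real.cos_le_cos_of_nonneg_of_le_pi h0.le (by linarith) (by linarith)
  have hα : 0 < α := hβ.trans_le hβα
  have hcs := Real.cos_sq_add_sin_sq θ
  have hsc2 : Real.sin θ ^ 2 ≤ Real.cos θ ^ 2 := by gcongr
  have hβα2 : β ^ 2 ≤ α ^ 2 := by gcongr
  rw [le_div_iff₀ (by positivity)] at hle
  have hsq : ∀ t, (schmidtAmplitude θ α β t * hadamardCoeff m t.2) ^ 2 =
      schmidtAmplitude θ α β t ^ 2 / 2 := fun t => by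
    rw [mul_pow, hadamardCoeff_sq]; ring
  have hne : ∀ t, schmidtAmplitude θ α β t * hadamardCoeff m t.2 ≠ 0 := by
    intro t
    refine mul_ne_zero (mul_ne_zero ?_ ?_) fun h => ?_
    · obtain ⟨i, j⟩ := t
      fin_cases i <;> simp [hsin.ne', hcos.ne']
    · obtain ⟨i, j⟩ := t
      fin_cases j <;> simp [hα.ne', hβ.ne']
    · have := hadamardCoeff_sq m t.2
      rw [h] at this
      norm_num at this
  have hsum := sum_schmidtAmplitude_sq (θ := θ) hnorm
  obtain ⟨Λ, hΛ, hbell⟩ := exists_isLOCC_diagonal_eq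
    (fun t => schmidtAmplitude θ α β t * hadamardCoeff m t.2) hne
    -- The first two conditions reduce to `sin² θ ≤ cos² θ` and `β² ≤ α²`; only the third uses
    -- `hle`.
    (by
      have := mul_le_mul_of_nonneg_right hsc2 (by positivity : 0 ≤ α ^ 2 + β ^ 2)
      simp only [hsq]
      simp only [schmidtAmplitude, Matrix.cons_val_zero, Matrix.cons_val_one]
      linarith)
    (by
      have := mul_le_mul_of_nonneg_left hβα2 (by positivity : 0 ≤ Real.cos θ ^ 2 + Real.sin θ ^ 2)
      simp only [hsq]
      simp only [schmidtAmplitude, Matrix.cons_val_zero, Matrix.cons_val_one]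
      linarith)
    (by
      simp only [Fintype.sum_prod_type, Fin.sum_univ_two] at hsum
      have : schmidtAmplitude θ α β (0, 0) ^ 2 ≤ 1 / 2 := by
        simp only [schmidtAmplitude, Matrix.cons_val_zero]
        linarith
      simp only [hsq]
      linarith)
  refine ⟨Λ, hΛ, ?_⟩
  simp only [hsq, ← Finset.sum_div, hsum] at hbell
  simpa [branchMatrix, hadamardKet_eq] using hbell

/-- The operator has rank one, so its rows give proportional kets and the mixture is pure; the two
factors `1/2` add to `1`. -/
lemma branchState_hadamardMeasurement (θ α β : ℝ) (m : Fin 2) :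
    branchState θ α β hadamardMeasurement m =
      pureState (ketOf (branchMatrix θ α β (hadamardKet m))) := by
  have h : ∀ k, ketOf (branchMatrix θ α β (hadamardMeasurement.op m k)) =
      (hadamardCoeff m k : ℂ) • ketOf (branchMatrix θ α β (hadamardKet m)) := by
    intro k
    ext ⟨x, y⟩
    by_cases hxy : x = y
    · subst hxy
      simp [ketOf, branchMatrix, hadamardMeasurement, pureState, Matrix.vecMulVec_apply,
        hadamardKet_eq]
      ring
    · simp [ketOf, branchMatrix, hxy]
  have h2 : ∀ k, (hadamardCoeff m k : ℂ) * star (hadamardCoeff m k : ℂ) = 1 / 2 := by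
    intro k
    rw [Complex.star_def, Complex.conj_ofReal, ← sq, ← Complex.ofReal_pow, hadamardCoeff_sq]
    norm_num
  rw [branchState_eq_sum]
  simp only [h, pureState_smul, h2, ← Finset.sum_smul]
  norm_num

lemma bankMeasuresFeasible_hadamardMeasurement {θ α β : ℝ} (hθ : θ ∈ Set.Ioc 0 (Real.pi / 4))
    (hβ : 0 < β) (hβα : β ≤ α) (hnorm : α ^ 2 + β ^ 2 = 1)
    (hle : α ^ 2 ≤ 1 / (2 * Real.cos θ ^ 2)) :
    BankMeasuresFeasible θ α β hadamardMeasurement := by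
  intro m h0
  obtain ⟨Λ, hΛ, hbell⟩ := exists_isLOCC_hadamard_branch hθ hβ hβα hnorm hle m
  refine ⟨Λ, hΛ, ?_⟩
  have htr : (branchState θ α β hadamardMeasurement m).trace = 1 / 2 := by
    rw [trace_branchState]
    have : ∀ k t, ‖branchMatrix θ α β (hadamardMeasurement.op m k) t t‖ ^ 2 =
        schmidtAmplitude θ α β t ^ 2 / 4 := by
      intro k t
      simp only [branchMatrix, Matrix.diagonal_apply_eq, hadamardMeasurement, pureState,
        Matrix.vecMulVec_apply, Pi.star_apply, hadamardKet_eq, norm_mul, norm_star, mul_pow,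
        Complex.norm_real, Real.norm_eq_abs, sq_abs, hadamardCoeff_sq]
      ring
    simp only [this, ← Finset.sum_div, sum_schmidtAmplitude_sq hnorm]
    norm_num
  rw [hΛ.isLinearMap.map_smul, htr, branchState_hadamardMeasurement, hbell, smul_smul]
  norm_num

lemma transferFeasible_of_le {θ α β : ℝ} (hθ : θ ∈ Set.Ioc 0 (Real.pi / 4))
    (hβ : 0 < β) (hβα : β ≤ α) (hnorm : α ^ 2 + β ^ 2 = 1)
    (hle : α ^ 2 ≤ 1 / (2 * Real.cos θ ^ 2)) : TransferFeasible θ α β := by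
  choose Λ hΛ hbell using exists_isLOCC_hadamard_branch hθ hβ hβα hnorm hle
  -- Alice applies the Hadamard bra to `K` and keeps `AA'`, which reproduces the Bank's branches
  -- exactly.
  let N : Fin 2 → Matrix (Qubit × Qubit) (Qubit × Qubit × Qubit) ℂ := fun m =>
    Matrix.of fun t x => if t = (x.1, x.2.1) then hadamardKet m x.2.2 else 0
  have hN : ∑ m, (N m)ᴴ * N m = 1 := by
    ext ⟨a, a', k⟩ ⟨b, b', l⟩
    have h := sum_hadamardKet_mul k l
    simp only [Matrix.sum_apply, Matrix.mul_apply, Matrix.conjTranspose_apply, N, Matrix.of_apply,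
      Matrix.one_apply]
    rw [Finset.sum_comm, Finset.sum_eq_single (a, a')]
    · by_cases hab : (a, a') = (b, b')
      · simp only [Prod.mk.injEq] at hab
        obtain ⟨rfl, rfl⟩ := hab
        simpa using h
      · have : ¬ (a, a', k) = (b, b', l) := by
          simp only [Prod.mk.injEq] at hab ⊢
          tauto
        simp only [if_neg hab, if_neg this, mul_zero, Finset.sum_const_zero]
    · intro t _ ht
      simp [ht]
    · simp
  have hNX : ∀ m, N m * transferMatrix θ α β = branchMatrix θ α β (hadamardKet m) := by
    intro m
    ext ⟨a, a'⟩ ⟨b, b'⟩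
    simp only [Matrix.mul_apply, N, Matrix.of_apply, transferMatrix, transferKet,
      linkKet_mul_ghzKet, branchMatrix, Matrix.diagonal_apply]
    rw [Finset.sum_eq_single (a, a', a')]
    · simp [mul_comm]
    · rintro ⟨c, c', k⟩ _ hne
      by_cases h1 : (a, a') = (c, c')
      · simp only [Prod.mk.injEq] at h1
        obtain ⟨rfl, rfl⟩ := h1
        have : k ≠ a' := fun h => hne (by rw [h])
        simp [this]
      · simp [h1]
    · simp
  refine ⟨_, .alice N hN Λ hΛ, ?_⟩
  change ∑ m, Λ m (_ * pureState (ketOf (transferMatrix θ α β)) * _) = _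
  simp only [mul_pureState_mul_conjTranspose, kronecker_one_mulVec_ketOf, hNX, hbell,
    ← Finset.sum_smul]
  norm_num

end AssistedTeleportation

theorem mainTheorem1 (θ α β : ℝ) (hθ : θ ∈ Set.Ioc 0 (Real.pi / 4)) (hβ : 0 < β) (hβα : β ≤ α)
    (hnorm : α ^ 2 + β ^ 2 = 1) :
    (AssistedTeleportation.BankMeasuresFeasible θ α β AssistedTeleportation.hadamardMeasurement ↔
        α ^ 2 ≤ 1 / (2 * Real.cos θ ^ 2)) ∧
      ((∃ M : AssistedTeleportation.BinaryMeasurement,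
          AssistedTeleportation.BankMeasuresFeasible θ α β M) ↔
        α ^ 2 ≤ 1 / (2 * Real.cos θ ^ 2)) ∧
      (AssistedTeleportation.TransferFeasible θ α β ↔ α ^ 2 ≤ 1 / (2 * Real.cos θ ^ 2)) := by
  have hpi := Real.pi_pos
  have hcos : 0 < Real.cos θ :=
    Real.cos_pos_of_mem_Ioo ⟨by linarith [hθ.1], by linarith [hθ.2]⟩
  have hnec : AssistedTeleportation.schmidtAmplitude θ α β (0, 0) ^ 2 ≤ 1 / 2 →
      α ^ 2 ≤ 1 / (2 * Real.cos θ ^ 2) := by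
    intro h
    simp only [AssistedTeleportation.schmidtAmplitude, Matrix.cons_val_zero] at h
    rw [le_div_iff₀ (by positivity)]
    linarith
  have hsuf := AssistedTeleportation.bankMeasuresFeasible_hadamardMeasurement hθ hβ hβα hnorm
  refine ⟨⟨fun h => hnec (h.schmidtAmplitude_sq_le hnorm _), hsuf⟩,
    ⟨fun ⟨_, h⟩ => hnec (h.schmidtAmplitude_sq_le hnorm _), fun h => ⟨_, hsuf h⟩⟩,
    ⟨fun h => hnec (h.schmidtAmplitude_sq_le _),
      AssistedTeleportation.transferFeasible_of_le hθ hβ hβα hnorm⟩⟩
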